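/- Let $b\in\mathbb R^2$ (receiver), $\lambda,\lambda_{I,m},\hat P_I,\tau\ge 0$ and $\alpha>2$. Let $\Phi=\{x_j\}$ (active IoT devices) and $\Phi_{I,m}=\{x'_{j'}\}$ (active incumbents on band $m$) be homogeneous Poisson point processes in the plane $\mathbb R^2$ with densities $\lambda$ and $\lambda_{I,m}$, let $h_i$, $(f_j)$, $(g_{j'})$ be i.i.d. fading gains with distribution $\mathrm{Exp}(1)$, and let $p_{i,b}$ be the distance from $b$ to a (possibly random) device $i$ in the plane. Assume that the location of device $i$, $h_i$, $\Phi$, $(f_j)$, $\Phi_{I,m}$ and $(g_{j'})$ are mutually independent. For a noise power $\hat P_N\ge 0$ put $$\mathrm{SINR}_{i,b,m}=\frac{h_i\,p_{i,b}^{-\alpha}}{\hat P_N+\sum_{j\in\Phi} f_j\,\|x_j-b\|^{-\alpha}+\sum_{j'\in\Phi_{I,m}}\hat P_I\,g_{j'}\,\|x'_{j'}-b\|^{-\alpha}}\in[0,\infty],$$ with $0^{-\alpha}=\infty$, $0\cdot\infty=0$, and $x/0=\infty$ for $x>0$. Then, if $\hat P_N=0$, almost surely $$\Pr(\mathrm{SINR}_{i,b,m}\ge\tau\mid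 p_{i,b})=\exp\left(-\epsilon_m\,\tau^{2/\alpha}\,p_{i,b}^2\right),\qquad \epsilon_m=\pi\left(\lambda+\hat P_I^{2/\alpha}\lambda_{I,m}\right)\frac{2\pi/\alpha}{\sin(2\pi/\alpha)}.$$ Moreover, along every sequence of noise powers $\hat P_N\ge0$ that tends to $0$, the conditional probabilities $\Pr(\mathrm{SINR}_{i,b,m}\ge\tau\mid p_{i,b})$ converge almost surely to the same expression. Finally, if $\hat P_I>0$, then $\hat P_I^{2/\alpha}\lambda_{I,m}\to\lambda_{I,m}$ as $\alpha\to\infty$. -/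

import Mathlib

open MeasureTheory ProbabilityTheory Filter Topology
open scoped ENNReal NNReal

/-- The Euclidean plane, with the Euclidean distance and Lebesgue measure. -/
abbrev Plane : Type := EuclideanSpace ℝ (Fin 2)

/-- A point process in `E` given by a measurable enumeration: `num ω ∈ ℕ ∪ {∞}` is the total
number of points, and the points are `pt k ω` for the indices `k < num ω`
(the values `pt k ω` with `k ≥ num ω` are not points of the process). -/
structure PointProcess (Ω E : Type*) [MeasurableSpace Ω] [MeasurableSpace E] where
  num : Ω → ℕ∞
  pt : ℕ → Ω → E
  measurable_num : Measurable num
  measurable_pt : ∀ k, Measurable (pt k)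

namespace PointProcess

variable {Ω E : Type*} [MeasurableSpace Ω] [MeasurableSpace E]

/-- The number of points of the process in the set `A`. -/
noncomputable def count (Φ : PointProcess Ω E) (A : Set E) (ω : Ω) : ℕ∞ :=
  Set.encard {k : ℕ | (k : ℕ∞) < Φ.num ω ∧ Φ.pt k ω ∈ A}

/-- The whole process as a single random element. -/
def toRandomElement (Φ : PointProcess Ω E) (ω : Ω) : ℕ∞ × (ℕ → E) :=
  (Φ.num ω, fun k => Φ.pt k ω)

end PointProcess

/-- `Φ` is a homogeneous Poisson point process in the plane with density `lam` (under `μ`): the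
number of points in a bounded Borel set `A` is Poisson with mean `lam * |A|`, and the numbers of
points in finitely many pairwise disjoint bounded Borel sets are independent. -/
structure IsHPPP {Ω : Type*} [MeasurableSpace Ω] (Φ : PointProcess Ω Plane) (lam : ℝ≥0)
    (μ : Measure Ω) : Prop where
  hasLaw_count : ∀ A : Set Plane, MeasurableSet A → Bornology.IsBounded A →
    HasLaw (Φ.count A)
      ((poissonMeasure (lam * (volume A).toNNReal)).map (Nat.cast : ℕ → ℕ∞)) μ
  iIndepFun_count : ∀ (n : ℕ) (A : Fin n → Set Plane), (∀ i, MeasurableSet (A i)) →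
    (∀ i, Bornology.IsBounded (A i)) → Pairwise (fun i j => Disjoint (A i) (A j)) →
    iIndepFun (fun i => Φ.count (A i)) μ

/-- The total power received at `b` from the points `x_k` of `Φ`, all transmitting with power `P`,
with fading gains `f_k` and path loss `dist(x_k, b) ^ (-α)`. -/
noncomputable def interference {Ω : Type*} [MeasurableSpace Ω] (P : ℝ≥0) (α : ℝ) (b : Plane)
    (Φ : PointProcess Ω Plane) (f : ℕ → Ω → ℝ) (ω : Ω) : ℝ≥0∞ :=
  ∑' k : ℕ, if (k : ℕ∞) < Φ.num ω then
    (P : ℝ≥0∞) * ENNReal.ofReal (f k ω) * edist (Φ.pt k ω) b ^ (-α) else 0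

/-- The signal to interference and noise ratio at the receiver `b` of a device at `y` with fading
gain `h`; `PN` and `PI` are the noise power and the power of the incumbents (`ΦI`, with fading
gains `g`), relative to the common power of the IoT devices (`Φ`, with fading gains `f`). -/
noncomputable def sinr {Ω : Type*} [MeasurableSpace Ω] (PN PI : ℝ≥0) (α : ℝ) (b : Plane)
    (y : Ω → Plane) (h : Ω → ℝ) (Φ : PointProcess Ω Plane) (f : ℕ → Ω → ℝ)
    (ΦI : PointProcess Ω Plane) (g : ℕ → Ω → ℝ) (ω : Ω) : ℝ≥0∞ :=
  (ENNReal.ofReal (h ω) * edist (y ω) b ^ (-α)) /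
    ((PN : ℝ≥0∞) + interference 1 α b Φ f ω + interference PI α b ΦI g ω)

/-- The constant `ε = π (λ + P_I ^ (2/α) λ_I) (2π/α) / sin (2π/α)`. -/
noncomputable def interferenceCoeff (lam lamI PI : ℝ≥0) (α : ℝ) : ℝ :=
  Real.pi * ((lam : ℝ) + (PI : ℝ) ^ (2 / α) * (lamI : ℝ)) *
    ((2 * Real.pi / α) / Real.sin (2 * Real.pi / α))

/-! Let `D` be noise plus interference and `r` the distance of the device. Almost surely the event
is `h ≥ τ r ^ α D`, and `h` is exponential and independent of `D`, so freezing `r` gives the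
probability `E exp (-s D)` with `s = τ r ^ α` (`condProb_ae_eq_of_indepFun`,
`measure_le_exp_mul_rpow_neg_div`). By independence this splits into `exp (-s PN)` and the Laplace
transforms of the two interferences.

For one interference with power `P`, averaging over the fading turns each point `x` into a factor `1
/ (1 + s P |x - b| ^ (-α))`. The Laplace functional of the Poisson process
(`IsHPPP.lintegral_expNeg_lintegral`) then leaves the integral of `1 - 1 / (1 + s P |x - b| ^ (-α))`
over the plane, which `lintegral_plane_one_sub_inv` evaluates by Euler's reflection formula. It
scales as `(s P) ^ (2 / α)`, whence the factors `τ ^ (2 / α)` and `r ^ 2`.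

Working with `[0, ∞]`-valued integrals of `expNeg`, which is bounded by `1`, admits infinite sums
and the singularity at `b` throughout. -/

/-- The function `x ↦ exp (-x)` on `[0, ∞]`, with value `0` at `∞`. -/
noncomputable def expNeg (x : ℝ≥0∞) : ℝ≥0∞ := EReal.exp (-(x : EReal))

@[simp] lemma expNeg_zero : expNeg 0 = 1 := by simp [expNeg]

@[simp] lemma expNeg_top : expNeg ∞ = 0 := by simp [expNeg]

lemma expNeg_add (x y : ℝ≥0∞) : expNeg (x + y) = expNeg x * expNeg y := by
  rw [expNeg, expNeg, expNeg, ← EReal.exp_add, EReal.coe_ennreal_add, EReal.neg_add, sub_eq_add_neg]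
  · left; simp
  · right; simp

lemma antitone_expNeg : Antitone expNeg := fun _ _ h =>
  EReal.exp_monotone (EReal.neg_le_neg_iff.2 (EReal.coe_ennreal_le_coe_ennreal_iff.2 h))

lemma expNeg_le_one (x : ℝ≥0∞) : expNeg x ≤ 1 := by
  simpa using antitone_expNeg (zero_le (a := x))

lemma expNeg_ne_top (x : ℝ≥0∞) : expNeg x ≠ ∞ := ((expNeg_le_one x).trans_lt (by simp)).ne

lemma continuous_expNeg : Continuous expNeg :=
  ENNReal.continuous_exp.comp (continuous_neg.comp continuous_coe_ennreal_ereal)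

@[fun_prop] lemma measurable_expNeg : Measurable expNeg := continuous_expNeg.measurable

lemma expNeg_ofReal {x : ℝ} (hx : 0 ≤ x) :
    expNeg (ENNReal.ofReal x) = ENNReal.ofReal (Real.exp (-x)) := by
  rw [expNeg, EReal.coe_ennreal_ofReal, max_eq_left hx, ← EReal.coe_neg, EReal.exp_coe]

lemma expNeg_sum {ι : Type*} (s : Finset ι) (u : ι → ℝ≥0∞) :
    expNeg (∑ i ∈ s, u i) = ∏ i ∈ s, expNeg (u i) := by
  classical
  induction s using Finset.induction_on with
  | empty => simp
  | insert a s ha ih => rw [Finset.sum_insert ha, Finset.prod_insert ha, expNeg_add, ih]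

lemma expNeg_nat_mul (n : ℕ) (c : ℝ≥0∞) : expNeg (n * c) = expNeg c ^ n := by
  induction n with
  | zero => simp
  | succ n ih => rw [Nat.cast_succ, add_mul, one_mul, expNeg_add, ih, pow_succ]

/-- Turns the product of fading factors over the points into the exponential of a sum, the form
required by the Laplace functional. -/
lemma expNeg_log_one_add (w : ℝ≥0∞) : expNeg (ENNReal.log (1 + w)).toENNReal = (1 + w)⁻¹ := by
  have h0 : 0 ≤ ENNReal.log (1 + w) := by simp
  rw [expNeg, EReal.coe_toENNReal h0, EReal.exp_neg, ENNReal.exp_log]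

/-! ### Exponential and Poisson distributions -/

lemma lintegral_expMeasure_one {F : ℝ → ℝ≥0∞} (hF : Measurable F) :
    ∫⁻ x, F x ∂expMeasure 1 = ∫⁻ x in Set.Ioi (0 : ℝ), ENNReal.ofReal (Real.exp (-x)) * F x := by
  have h : expMeasure 1 = volume.withDensity (exponentialPDF 1) := rfl
  have hm : Measurable (exponentialPDF 1) := by unfold exponentialPDF; fun_prop
  rw [h, lintegral_withDensity_eq_lintegral_mul _ hm hF,
    ← lintegral_indicator measurableSet_Ioi]
  refine lintegral_congr_ae ?_
  filter_upwards [compl_mem_ae_iff.2 (measure_singleton (0 : ℝ))] with x hx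
  rcases lt_or_gt_of_ne (show x ≠ 0 from hx) with h | h
  · simp [exponentialPDF_of_neg h, h.le]
  · simp [exponentialPDF_of_nonneg h.le, h]

lemma ae_pos_expMeasure_one : ∀ᵐ x ∂expMeasure 1, 0 < x := by
  have h : expMeasure 1 {x | ¬ 0 < x} = 0 := by
    have hs : MeasurableSet {x : ℝ | ¬ 0 < x} := by measurability
    rw [← lintegral_indicator_one hs, lintegral_expMeasure_one (measurable_one.indicator hs),
      setLIntegral_congr_fun (g := fun _ => 0) measurableSet_Ioi, lintegral_zero]
    intro x hx
    simpa using Or.inr hx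
  exact h

/-- A non-integrable function has Bochner integral `0` by convention, so a nonzero value already
forces integrability. -/
lemma lintegral_ofReal_of_integral_eq {X : Type*} [MeasurableSpace X] {ν : Measure X} {F : X → ℝ}
    {c : ℝ} (hF : ∀ᵐ x ∂ν, 0 ≤ F x) (hc : c ≠ 0) (h : ∫ x, F x ∂ν = c) :
    ∫⁻ x, ENNReal.ofReal (F x) ∂ν = ENNReal.ofReal c := by
  have hi : Integrable F ν := by
    by_contra hn
    exact hc (by rw [← h, integral_undef hn])
  rw [← h, ofReal_integral_eq_lintegral_ofReal hi hF]

/-- The Laplace transform of the exponential distribution. -/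
lemma lintegral_expNeg_mul_expMeasure_one (c : ℝ≥0∞) :
    ∫⁻ x, expNeg (c * ENNReal.ofReal x) ∂expMeasure 1 = (1 + c)⁻¹ := by
  induction c with
  | top =>
    rw [add_top, ENNReal.inv_top, lintegral_eq_zero_iff (by fun_prop)]
    filter_upwards [ae_pos_expMeasure_one] with x hx
    simp [ENNReal.top_mul, hx]
  | coe c =>
    rw [lintegral_expMeasure_one (by fun_prop)]
    have h1 : ∀ x ∈ Set.Ioi (0 : ℝ), ENNReal.ofReal (Real.exp (-x)) *
        expNeg (c * ENNReal.ofReal x) = ENNReal.ofReal (Real.exp (-(1 + c) * x)) := by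
      intro x hx
      have hx : 0 < x := hx
      rw [← ENNReal.ofReal_coe_nnreal, ← ENNReal.ofReal_mul (by positivity),
        expNeg_ofReal (by positivity), ← ENNReal.ofReal_mul (by positivity), ← Real.exp_add]
      congr 2; ring
    have hc : (0 : ℝ) < 1 + c := by positivity
    rw [setLIntegral_congr_fun measurableSet_Ioi h1,
      lintegral_ofReal_of_integral_eq (c := (1 + (c : ℝ))⁻¹) (ae_of_all _ fun x => by positivity)
        (by positivity), ENNReal.ofReal_inv_of_pos hc, ENNReal.ofReal_add (by simp) (by simp)]
    · simp
    · rw [integral_exp_mul_Ioi (by linarith)]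
      field_simp
      simp

/-- The tail of the exponential distribution. -/
lemma expMeasure_one_setOf_le_ofReal (t : ℝ≥0∞) :
    expMeasure 1 {x | t ≤ ENNReal.ofReal x} = expNeg t := by
  have hP : IsProbabilityMeasure (expMeasure 1) := isProbabilityMeasure_expMeasure one_pos
  induction t with
  | top => simp
  | coe t =>
    rcases eq_or_ne t 0 with rfl | ht
    · simp
    have h1 : {x : ℝ | (t : ℝ≥0∞) ≤ ENNReal.ofReal x} = Set.Ici (t : ℝ) := by
      ext x
      rw [Set.mem_ofPred_eq, Set.mem_Ici, ← ENNReal.ofReal_coe_nnreal]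
      refine ⟨fun h => ?_, ENNReal.ofReal_le_ofReal⟩
      by_contra! hlt
      have : (0 : ℝ) < t := by positivity
      exact absurd ((ENNReal.ofReal_lt_ofReal_iff this).2 hlt) (not_lt.2 h)
    have ht' : (0 : ℝ) < t := by positivity
    have h2 : ∀ x ∈ Set.Ioi (0 : ℝ), ENNReal.ofReal (Real.exp (-x)) *
        (Set.Ici (t : ℝ)).indicator 1 x
        = (Set.Ici (t : ℝ)).indicator (fun x => ENNReal.ofReal (Real.exp (-x))) x := by
      intro x _
      by_cases hx : x ∈ Set.Ici (t : ℝ) <;> simp [hx]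
    rw [h1, ← lintegral_indicator_one measurableSet_Ici,
      lintegral_expMeasure_one (measurable_one.indicator measurableSet_Ici),
      setLIntegral_congr_fun measurableSet_Ioi h2, lintegral_indicator measurableSet_Ici,
      Measure.restrict_restrict measurableSet_Ici,
      Set.inter_eq_left.2 (Set.Ici_subset_Ioi.2 ht'), setLIntegral_congr Ioi_ae_eq_Ici.symm,
      lintegral_ofReal_of_integral_eq (c := Real.exp (-t)) (ae_of_all _ fun x => by positivity)
        (by positivity) (integral_exp_neg_Ioi _), ← ENNReal.ofReal_coe_nnreal,
      expNeg_ofReal ht'.le]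

/-- The Laplace transform of the Poisson distribution. -/
lemma lintegral_expNeg_mul_poissonMeasure (r : ℝ≥0) (c : ℝ≥0∞) :
    ∫⁻ n, expNeg (n * c) ∂poissonMeasure r = expNeg (r * (1 - expNeg c)) := by
  obtain ⟨q, hq⟩ : ∃ q : ℝ≥0, expNeg c = q := ⟨_, (ENNReal.coe_toNNReal (expNeg_ne_top c)).symm⟩
  have hq1 : q ≤ 1 := by exact_mod_cast hq ▸ expNeg_le_one c
  have hq1' : (q : ℝ) ≤ 1 := hq1
  have h1 : ∀ n : ℕ, ENNReal.ofReal (Real.exp (-r) * r ^ n / n.factorial) * expNeg (n * c)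
      = ENNReal.ofReal (Real.exp (-r) * ((r * q : ℝ) ^ n / n.factorial)) := by
    intro n
    rw [expNeg_nat_mul, hq, ← ENNReal.ofReal_coe_nnreal, ← ENNReal.ofReal_pow (by positivity),
      ← ENNReal.ofReal_mul (by positivity)]
    congr 1; ring
  have hs := (NormedSpace.expSeries_div_hasSum_exp (r * q : ℝ)).mul_left (Real.exp (-r))
  rw [← Real.exp_eq_exp_ℝ] at hs
  rw [poissonMeasure, lintegral_sum_measure]
  simp_rw [lintegral_smul_measure, lintegral_dirac, smul_eq_mul, h1]
  rw [← ENNReal.ofReal_tsum_of_nonneg (fun n => by positivity) hs.summable, hs.tsum_eq, hq,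
    ← Real.exp_add, ← ENNReal.coe_one, ← ENNReal.coe_sub, ← ENNReal.coe_mul,
    ← ENNReal.ofReal_coe_nnreal, expNeg_ofReal (by positivity), NNReal.coe_mul,
    NNReal.coe_sub hq1]
  congr 2; push_cast; ring

/-! ### The path-loss integral over the plane -/

/-- The right-hand side is the Laplace transform of the exponential law at `w⁻¹`; this opens the way
to Tonelli in the path-loss integral. -/
lemma one_sub_inv_one_add (w : ℝ≥0∞) : 1 - (1 + w)⁻¹ = (1 + w⁻¹)⁻¹ := by
  induction w with
  | top => simp
  | coe w =>
    rcases eq_or_ne w 0 with rfl | hw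
    · simp
    have h : (1 : ℝ≥0) - (1 + w)⁻¹ = (1 + w⁻¹)⁻¹ := by
      have h2 : (1 + w)⁻¹ ≤ 1 := inv_le_one_of_one_le₀ (by simp)
      have hw' : (0 : ℝ) < w := by positivity
      ext
      rw [NNReal.coe_sub h2]
      push_cast
      field_simp
      ring
    rw [← ENNReal.coe_inv hw, ← ENNReal.coe_one, ← ENNReal.coe_add, ← ENNReal.coe_add,
      ← ENNReal.coe_inv (by positivity), ← ENNReal.coe_inv (by positivity), ← ENNReal.coe_sub, h]

lemma lintegral_plane_exp_neg_mul_norm_rpow {p c : ℝ} (hp : 1 ≤ p) (hc : 0 < c) :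
    ∫⁻ x : Plane, ENNReal.ofReal (Real.exp (-c * ‖x‖ ^ p)) =
      ENNReal.ofReal (Real.pi * c ^ (-2 / p) * Real.Gamma (2 / p + 1)) := by
  have hG : 0 < Real.Gamma (2 / p + 1) := Real.Gamma_pos_of_pos (by positivity)
  -- The integral is known over `ℂ`; the coordinate isometry onto the plane preserves norm and
  -- volume.
  have hmp := Complex.orthonormalBasisOneI.repr.measurePreserving
  rw [← hmp.lintegral_comp (by fun_prop)]
  simp_rw [LinearIsometryEquiv.norm_map]
  exact lintegral_ofReal_of_integral_eq (ae_of_all _ fun x => by positivity) (by positivity)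
    (Complex.integral_exp_neg_mul_rpow hp hc)

lemma lintegral_expNeg_mul_edist_rpow {α t : ℝ} (hα : 1 ≤ α) (b : Plane) {s : ℝ≥0} (hs : 0 < s)
    (ht : 0 < t) :
    ∫⁻ x : Plane, expNeg ((s * edist x b ^ (-α))⁻¹ * ENNReal.ofReal t) =
      ENNReal.ofReal (Real.pi * (t / s) ^ (-2 / α) * Real.Gamma (2 / α + 1)) := by
  have hs' : (0 : ℝ) < s := hs
  rw [← lintegral_plane_exp_neg_mul_norm_rpow hα (by positivity : 0 < t / s),
    
    ← lintegral_sub_right_eq_self (fun x : Plane => ENNReal.ofReal (Real.exp (-(t / s) * ‖x‖ ^ α))) b]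
  refine lintegral_congr fun x => ?_
  rw [edist_dist, dist_eq_norm, ENNReal.mul_inv (by simp [hs.ne']) (by simp), ← ENNReal.rpow_neg,
    neg_neg, ENNReal.ofReal_rpow_of_nonneg (norm_nonneg _) (by linarith), ← ENNReal.coe_inv hs.ne',
    ← ENNReal.ofReal_coe_nnreal, ← ENNReal.ofReal_mul (by positivity),
    ← ENNReal.ofReal_mul (by positivity), expNeg_ofReal (by positivity)]
  congr 2
  push_cast
  ring

lemma pi_mul_Gamma_mul_Gamma {δ : ℝ} (h0 : 0 < δ) :
    Real.pi * (Real.Gamma (δ + 1) * Real.Gamma (1 - δ)) =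
      Real.pi * ((Real.pi * δ) / Real.sin (Real.pi * δ)) := by
  rw [Real.Gamma_add_one h0.ne', mul_assoc, Real.Gamma_mul_Gamma_one_sub]
  ring

/-- Write the integrand as an average of `exp (-t |x - b| ^ α / s)` over exponential `t` and swap
the integrals. The plane integral gives `Γ(2/α + 1)` times a multiple of `t ^ (-2/α)`, and the
`t`-integral gives `Γ(1 - 2/α)`, convergent because `α > 2`. Reflection produces the sine. -/
lemma lintegral_plane_one_sub_inv {α : ℝ} (hα : 2 < α) (b : Plane) (s : ℝ≥0) :
    ∫⁻ x : Plane, (1 - (1 + s * edist x b ^ (-α))⁻¹) =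
      ENNReal.ofReal ((s : ℝ) ^ (2 / α) *
        (Real.pi * ((2 * Real.pi / α) / Real.sin (2 * Real.pi / α)))) := by
  have hα0 : 0 < α := by linarith
  rcases eq_or_ne s 0 with rfl | hs
  · have h : (0 : ℝ) ^ (2 / α) = 0 := Real.zero_rpow (by positivity)
    simp [h]
  have hs : 0 < s := by positivity
  have hs' : (0 : ℝ) < s := hs
  have hP : IsProbabilityMeasure (expMeasure 1) := isProbabilityMeasure_expMeasure one_pos
  have hδ : 0 < 1 - 2 / α := by
    have : 2 / α < 1 := by rw [div_lt_one hα0]; exact hα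
    linarith
  have hG1 : 0 < Real.Gamma (2 / α + 1) := Real.Gamma_pos_of_pos (by positivity)
  have hG2 : 0 < Real.Gamma (1 - 2 / α) := Real.Gamma_pos_of_pos hδ
  simp_rw [one_sub_inv_one_add, ← lintegral_expNeg_mul_expMeasure_one]
  rw [lintegral_lintegral_swap (by fun_prop), lintegral_expMeasure_one (by fun_prop)]
  have h1 : ∀ t ∈ Set.Ioi (0 : ℝ), ENNReal.ofReal (Real.exp (-t)) *
      ∫⁻ x : Plane, expNeg ((s * edist x b ^ (-α))⁻¹ * ENNReal.ofReal t) =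
      ENNReal.ofReal ((s : ℝ) ^ (2 / α) * Real.pi * Real.Gamma (2 / α + 1) *
        (Real.exp (-t) * t ^ ((1 - 2 / α) - 1))) := by
    intro t ht
    have ht : 0 < t := ht
    rw [lintegral_expNeg_mul_edist_rpow (by linarith) b hs ht,
      ← ENNReal.ofReal_mul (by positivity), Real.div_rpow ht.le hs'.le, neg_div,
      Real.rpow_neg hs'.le, show (1 - 2 / α) - 1 = -(2 / α) by ring]
    congr 1
    field_simp
  rw [setLIntegral_congr_fun measurableSet_Ioi h1,
    lintegral_ofReal_of_integral_eq (c := (s : ℝ) ^ (2 / α) * Real.pi * Real.Gamma (2 / α + 1) *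
      Real.Gamma (1 - 2 / α)) _ (by positivity)]
  · rw [show 2 * Real.pi / α = Real.pi * (2 / α) by ring,
      ← pi_mul_Gamma_mul_Gamma (by positivity)]
    congr 1; ring
  · rw [integral_const_mul, Real.Gamma_eq_integral hδ]
  · filter_upwards [ae_restrict_mem measurableSet_Ioi] with t ht
    have ht : 0 < t := ht
    positivity

/-! ### Point processes as random counting measures -/

namespace PointProcess

variable {Ω E : Type*} [MeasurableSpace Ω] [MeasurableSpace E]

/-- The random counting measure of a point process. -/
noncomputable def toMeasure (Φ : PointProcess Ω E) (ω : Ω) : Measure E :=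
  Measure.sum fun k : ℕ => if (k : ℕ∞) < Φ.num ω then Measure.dirac (Φ.pt k ω) else 0

lemma lintegral_toMeasure (Φ : PointProcess Ω E) (ω : Ω) {u : E → ℝ≥0∞} (hu : Measurable u) :
    ∫⁻ x, u x ∂Φ.toMeasure ω = ∑' k : ℕ, if (k : ℕ∞) < Φ.num ω then u (Φ.pt k ω) else 0 := by
  rw [toMeasure, lintegral_sum_measure]
  congr 1 with k
  split_ifs
  · exact lintegral_dirac' _ hu
  · simp

lemma toMeasure_apply (Φ : PointProcess Ω E) (ω : Ω) {A : Set E} (hA : MeasurableSet A) :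
    Φ.toMeasure ω A = (Φ.count A ω : ℝ≥0∞) := by
  rw [← lintegral_indicator_one hA, lintegral_toMeasure _ _ (measurable_one.indicator hA), count,
    ← ENNReal.tsum_set_one, tsum_subtype _ (fun _ => (1 : ℝ≥0∞))]
  congr 1 with k
  by_cases h1 : (k : ℕ∞) < Φ.num ω <;> by_cases h2 : Φ.pt k ω ∈ A <;> simp [h1, h2]

lemma measurableSet_lt_num (Φ : PointProcess Ω E) (k : ℕ) :
    MeasurableSet {ω | (k : ℕ∞) < Φ.num ω} :=
  Φ.measurable_num (MeasurableSet.of_discrete (s := Set.Ioi (k : ℕ∞)))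

lemma measurable_lintegral_toMeasure (Φ : PointProcess Ω E) {u : E → ℝ≥0∞} (hu : Measurable u) :
    Measurable fun ω => ∫⁻ x, u x ∂Φ.toMeasure ω := by
  simp_rw [lintegral_toMeasure _ _ hu]
  exact Measurable.tsum fun k => Measurable.ite (Φ.measurableSet_lt_num k)
    (hu.comp (Φ.measurable_pt k)) measurable_const

lemma measurable_toMeasure_apply (Φ : PointProcess Ω E) {A : Set E} (hA : MeasurableSet A) :
    Measurable fun ω => Φ.toMeasure ω A := by
  simp_rw [← lintegral_indicator_one hA]
  exact Φ.measurable_lintegral_toMeasure (measurable_one.indicator hA)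

end PointProcess

/-! ### The Laplace functional of a Poisson process -/

namespace IsHPPP

variable {Ω : Type*} [MeasurableSpace Ω] {μ : Measure Ω} {Φ : PointProcess Ω Plane} {lam : ℝ≥0}

lemma lintegral_expNeg_mul_toMeasure (hΦ : IsHPPP Φ lam μ) {A : Set Plane}
    (hA : MeasurableSet A) (hb : Bornology.IsBounded A) (c : ℝ≥0∞) :
    ∫⁻ ω, expNeg (c * Φ.toMeasure ω A) ∂μ = expNeg (lam * ((1 - expNeg c) * volume A)) := by
  have hlaw := hΦ.hasLaw_count A hA hb
  have hF : Measurable fun n : ℕ∞ => expNeg ((n : ℝ≥0∞) * c) := .of_discrete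
  have h1 : ∫⁻ ω, expNeg (c * Φ.toMeasure ω A) ∂μ
      = ∫⁻ ω, (fun n : ℕ∞ => expNeg ((n : ℝ≥0∞) * c)) (Φ.count A ω) ∂μ := by
    simp_rw [Φ.toMeasure_apply _ hA, mul_comm c]
  rw [h1, ← lintegral_map' hF.aemeasurable hlaw.aemeasurable, hlaw.map_eq,
    lintegral_map hF .of_discrete]
  simp_rw [ENat.toENNReal_coe]
  rw [lintegral_expNeg_mul_poissonMeasure, ENNReal.coe_mul,
    ENNReal.coe_toNNReal hb.measure_lt_top.ne, mul_assoc, mul_comm (volume A)]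

/-- The Laplace functional of a Poisson process at a simple function supported in a bounded set. -/
lemma lintegral_expNeg_setLIntegral_simpleFunc (hΦ : IsHPPP Φ lam μ) {S : Set Plane}
    (hS : MeasurableSet S) (hb : Bornology.IsBounded S) (v : SimpleFunc Plane ℝ≥0∞) :
    ∫⁻ ω, expNeg (∫⁻ x in S, v x ∂Φ.toMeasure ω) ∂μ =
      expNeg (lam * ∫⁻ x in S, (1 - expNeg (v x))) := by
  classical
  -- The level sets of `v` within `S` are disjoint and bounded, so their counts are independent
  -- Poisson variables and the expectation factors over the values of `v`.
  let e := v.range.equivFin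
  let A : Fin v.range.card → Set Plane := fun i => v ⁻¹' {((e.symm i : v.range) : ℝ≥0∞)} ∩ S
  have hA : ∀ i, MeasurableSet (A i) := fun i => (v.measurableSet_fiber _).inter hS
  have hAb : ∀ i, Bornology.IsBounded (A i) := fun i => hb.subset Set.inter_subset_right
  have hd : Pairwise fun i j => Disjoint (A i) (A j) := by
    intro i j hij
    refine Set.disjoint_left.2 fun x hx hy => hij ?_
    have h : ((e.symm i : v.range) : ℝ≥0∞) = (e.symm j : v.range) := hx.1.symm.trans hy.1
    exact e.symm.injective (Subtype.ext h)
  have hsum : ∀ F : ℝ≥0∞ → ℝ≥0∞,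
      ∑ r ∈ v.range, F r = ∑ i, F (e.symm i : v.range) := by
    intro F
    rw [← Finset.sum_coe_sort v.range, ← Equiv.sum_comp e.symm]
  have h1 : ∀ ω, ∫⁻ x in S, v x ∂Φ.toMeasure ω
      = ∑ i, ((e.symm i : v.range) : ℝ≥0∞) * Φ.toMeasure ω (A i) := by
    intro ω
    rw [SimpleFunc.lintegral_eq_lintegral, SimpleFunc.lintegral, hsum]
    refine Finset.sum_congr rfl fun i _ => ?_
    rw [Measure.restrict_apply (v.measurableSet_fiber _)]
  have h2 : ∫⁻ x in S, (1 - expNeg (v x))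
      = ∑ i, (1 - expNeg ((e.symm i : v.range) : ℝ≥0∞)) * volume (A i) := by
    have := SimpleFunc.lintegral_eq_lintegral (v.map fun r => 1 - expNeg r) (volume.restrict S)
    rw [SimpleFunc.map_lintegral, hsum] at this
    refine this.trans (Finset.sum_congr rfl fun i _ => ?_)
    rw [Measure.restrict_apply (v.measurableSet_fiber _)]
  have hind : iIndepFun (fun i ω =>
      expNeg (((e.symm i : v.range) : ℝ≥0∞) * Φ.toMeasure ω (A i))) μ := by
    have := (hΦ.iIndepFun_count _ A hA hAb hd).comp
      (fun i (n : ℕ∞) => expNeg (((e.symm i : v.range) : ℝ≥0∞) * n)) (fun i => .of_discrete)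
    convert this using 3 with i
    simp [Φ.toMeasure_apply _ (hA i)]
  simp_rw [h1, expNeg_sum]
  rw [lintegral_prod_eq_prod_lintegral_of_indepFun _ _ hind, h2, Finset.mul_sum, expNeg_sum]
  · exact Finset.prod_congr rfl fun i _ => hΦ.lintegral_expNeg_mul_toMeasure (hA i) (hAb i) _
  · exact fun i => measurable_expNeg.comp ((Φ.measurable_toMeasure_apply (hA i)).const_mul _)

/-- The Laplace functional of a Poisson process. -/
theorem lintegral_expNeg_lintegral [IsFiniteMeasure μ] (hΦ : IsHPPP Φ lam μ)
    {u : Plane → ℝ≥0∞} (hu : Measurable u) :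
    ∫⁻ ω, expNeg (∫⁻ x, u x ∂Φ.toMeasure ω) ∂μ = expNeg (lam * ∫⁻ x, (1 - expNeg (u x))) := by
  -- Simple approximations cut off to growing balls increase to `u`. Monotone convergence handles
  -- the integrals over the plane, and domination by `1` the expectation.
  let S : ℕ → Set Plane := fun n => Metric.ball 0 n
  let v : ℕ → Plane → ℝ≥0∞ := fun n => (S n).indicator (SimpleFunc.eapprox u n)
  have hS : ∀ n, MeasurableSet (S n) := fun n => Metric.isOpen_ball.measurableSet
  have hv : ∀ n, Measurable (v n) := fun n => (SimpleFunc.measurable _).indicator (hS n)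
  have hmono : Monotone v := by
    intro m n hmn x
    refine Set.indicator_le_indicator_of_subset (Metric.ball_subset_ball (Nat.cast_le.2 hmn))
      (fun _ => zero_le) x |>.trans ?_
    exact Set.indicator_le_indicator (SimpleFunc.monotone_eapprox u hmn x)
  have hlim : ∀ x, Tendsto (fun n => v n x) atTop (𝓝 (u x)) := by
    intro x
    have h1 : Tendsto (fun n => SimpleFunc.eapprox u n x) atTop (𝓝 (u x)) :=
      SimpleFunc.tendsto_eapprox hu x
    refine h1.congr' ?_
    obtain ⟨N, hN⟩ := exists_nat_gt ‖x‖
    filter_upwards [eventually_ge_atTop N] with n hn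
    have : x ∈ S n := by
      have : (N : ℝ) ≤ n := by exact_mod_cast hn
      simp only [S, mem_ball_zero_iff]; linarith
    simp [v, this]
  have hn : ∀ n, ∫⁻ ω, expNeg (∫⁻ x, v n x ∂Φ.toMeasure ω) ∂μ
      = expNeg (lam * ∫⁻ x, (1 - expNeg (v n x))) := by
    intro n
    have h := hΦ.lintegral_expNeg_setLIntegral_simpleFunc (hS n) Metric.isBounded_ball
      (SimpleFunc.eapprox u n)
    simp_rw [← lintegral_indicator (hS n)] at h
    refine h.trans ?_
    congr 3 with x
    by_cases hx : x ∈ S n <;> simp [v, hx]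
  have hR : Tendsto (fun n => expNeg (lam * ∫⁻ x, (1 - expNeg (v n x)))) atTop
      (𝓝 (expNeg (lam * ∫⁻ x, (1 - expNeg (u x))))) := by
    refine (continuous_expNeg.tendsto _).comp (ENNReal.Tendsto.const_mul ?_ (by simp))
    refine lintegral_tendsto_of_tendsto_of_monotone
      (fun n => (measurable_const.sub (measurable_expNeg.comp (hv n))).aemeasurable)
      (ae_of_all _ fun x m n hmn => tsub_le_tsub_left (antitone_expNeg (hmono hmn x)) _)
      (ae_of_all _ fun x => ?_)
    exact ENNReal.Tendsto.sub tendsto_const_nhds ((continuous_expNeg.tendsto _).comp (hlim x))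
      (by simp)
  have hL : Tendsto (fun n => ∫⁻ ω, expNeg (∫⁻ x, v n x ∂Φ.toMeasure ω) ∂μ) atTop
      (𝓝 (∫⁻ ω, expNeg (∫⁻ x, u x ∂Φ.toMeasure ω) ∂μ)) := by
    refine tendsto_lintegral_of_dominated_convergence (fun _ => 1)
      (fun n => measurable_expNeg.comp (Φ.measurable_lintegral_toMeasure (hv n)))
      (fun n => ae_of_all _ fun ω => expNeg_le_one _) (by simp) (ae_of_all _ fun ω => ?_)
    refine (continuous_expNeg.tendsto _).comp ?_
    exact lintegral_tendsto_of_tendsto_of_monotone (fun n => (hv n).aemeasurable)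
      (ae_of_all _ fun x m n hmn => hmono hmn x) (ae_of_all _ hlim)
  simp_rw [hn] at hL
  exact tendsto_nhds_unique hL hR

end IsHPPP

/-! ### Fading and the Laplace transform of the interference -/

/-- The logarithm of `1 + c`, for `c ∈ [0, ∞]`. -/
noncomputable def logOneAdd (c : ℝ≥0∞) : ℝ≥0∞ := (ENNReal.log (1 + c)).toENNReal

@[simp] lemma logOneAdd_zero : logOneAdd 0 = 0 := by simp [logOneAdd]

@[fun_prop] lemma measurable_logOneAdd : Measurable logOneAdd := by unfold logOneAdd; fun_prop

/-- Independence factors the expectation for finite partial sums, with factors `(1 + c k)⁻¹`;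
domination by `1` gives the limit even when the series diverges. -/
lemma lintegral_expNeg_tsum_mul_of_exp {Ω : Type*} [MeasurableSpace Ω] {μ : Measure Ω}
    [IsProbabilityMeasure μ] {f : ℕ → Ω → ℝ} (hf : ∀ k, Measurable (f k))
    (hf_law : ∀ k, HasLaw (f k) (expMeasure 1) μ) (hf_indep : iIndepFun f μ) (c : ℕ → ℝ≥0∞) :
    ∫⁻ ω, expNeg (∑' k, c k * ENNReal.ofReal (f k ω)) ∂μ = expNeg (∑' k, logOneAdd (c k)) := by
  have hm : ∀ k, Measurable fun x : ℝ => expNeg (c k * ENNReal.ofReal x) := fun k => by fun_prop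
  have hN : ∀ N : ℕ, ∫⁻ ω, expNeg (∑ k ∈ Finset.range N, c k * ENNReal.ofReal (f k ω)) ∂μ
      = expNeg (∑ k ∈ Finset.range N, logOneAdd (c k)) := by
    intro N
    simp_rw [expNeg_sum]
    refine (lintegral_prod_eq_prod_lintegral_of_indepFun (Finset.range N) _
      (hf_indep.comp _ hm) fun k => (hm k).comp (hf k)).trans (Finset.prod_congr rfl fun k _ => ?_)
    rw [logOneAdd, expNeg_log_one_add, ← lintegral_expNeg_mul_expMeasure_one, ← (hf_law k).map_eq,
      lintegral_map (hm k) (hf k)]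
    rfl
  have hR := (continuous_expNeg.tendsto _).comp
    (ENNReal.summable (f := fun k => logOneAdd (c k))).hasSum.tendsto_sum_nat
  refine tendsto_nhds_unique ?_ hR
  simp_rw [Function.comp_def, ← hN]
  refine tendsto_lintegral_of_dominated_convergence (fun _ => 1) (fun N => by fun_prop)
    (fun n => ae_of_all _ fun ω => expNeg_le_one _) (by simp) (ae_of_all _ fun ω => ?_)
  exact (continuous_expNeg.tendsto _).comp ENNReal.summable.hasSum.tendsto_sum_nat

/-- The interference as a function of the enumerated points and of the fading gains. -/
noncomputable def interferenceFun (P : ℝ≥0) (α : ℝ) (b : Plane)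
    (p : (ℕ∞ × (ℕ → Plane)) × (ℕ → ℝ)) : ℝ≥0∞ :=
  ∑' k : ℕ, if (k : ℕ∞) < p.1.1 then
    (P : ℝ≥0∞) * ENNReal.ofReal (p.2 k) * edist (p.1.2 k) b ^ (-α) else 0

lemma measurable_interferenceFun (P : ℝ≥0) (α : ℝ) (b : Plane) :
    Measurable (interferenceFun P α b) := by
  refine Measurable.tsum fun k => Measurable.ite ?_ ?_ measurable_const
  · exact (measurable_fst.comp measurable_fst) (MeasurableSet.of_discrete (s := Set.Ioi (k : ℕ∞)))
  · fun_prop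

lemma PointProcess.measurable_toRandomElement {Ω E : Type*} [MeasurableSpace Ω]
    [MeasurableSpace E] (Φ : PointProcess Ω E) : Measurable Φ.toRandomElement :=
  Φ.measurable_num.prodMk (measurable_pi_lambda _ Φ.measurable_pt)

section Interference

variable {Ω : Type*} [MeasurableSpace Ω] {μ : Measure Ω} [IsProbabilityMeasure μ]
  {Φ : PointProcess Ω Plane} {lam : ℝ≥0} {f : ℕ → Ω → ℝ}

lemma measurable_interference (P : ℝ≥0) (α : ℝ) (b : Plane) (Φ : PointProcess Ω Plane)
    (hf : ∀ k, Measurable (f k)) : Measurable (interference P α b Φ f) :=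
  (measurable_interferenceFun P α b).comp
    (Φ.measurable_toRandomElement.prodMk (measurable_pi_lambda _ hf))

/-- Since points and gains are independent, Fubini allows the points to be frozen while the gains
are averaged. -/
lemma lintegral_expNeg_mul_interference_eq (hf : ∀ k, Measurable (f k))
    (hf_law : ∀ k, HasLaw (f k) (expMeasure 1) μ) (hf_indep : iIndepFun f μ)
    (hind : IndepFun Φ.toRandomElement (fun ω k => f k ω) μ) (P s : ℝ≥0) (α : ℝ) (b : Plane) :
    ∫⁻ ω, expNeg (s * interference P α b Φ f ω) ∂μ =
      ∫⁻ ω, expNeg (∫⁻ x, logOneAdd ((s * P : ℝ≥0) * edist x b ^ (-α)) ∂Φ.toMeasure ω) ∂μ := by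
  have hfm : Measurable fun ω k => f k ω := measurable_pi_lambda _ hf
  have hΦm := Φ.measurable_toRandomElement
  have hF : Measurable fun p => expNeg (s * interferenceFun P α b p) :=
    measurable_expNeg.comp ((measurable_interferenceFun P α b).const_mul _)
  have hprod := (indepFun_iff_map_prod_eq_prod_map_map hΦm.aemeasurable hfm.aemeasurable).1 hind
  have h1 : ∫⁻ ω, expNeg (s * interference P α b Φ f ω) ∂μ
      = ∫⁻ ω, ∫⁻ ω', expNeg (s * interferenceFun P α b (Φ.toRandomElement ω, fun k => f k ω'))
        ∂μ ∂μ := by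
    have : IsProbabilityMeasure (μ.map fun ω k => f k ω) :=
      Measure.isProbabilityMeasure_map hfm.aemeasurable
    calc _ = ∫⁻ p, expNeg (s * interferenceFun P α b p)
              ∂μ.map fun ω => (Φ.toRandomElement ω, fun k => f k ω) :=
          (lintegral_map hF (hΦm.prodMk hfm)).symm
      _ = _ := by
          rw [hprod, lintegral_prod _ hF.aemeasurable, lintegral_map hF.lintegral_prod_right' hΦm]
          refine lintegral_congr fun ω => ?_
          exact lintegral_map (hF.comp measurable_prodMk_left) hfm
  rw [h1]
  refine lintegral_congr fun ω => ?_
  rw [Φ.lintegral_toMeasure ω (by fun_prop)]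
  -- Indices beyond the number of points get coefficient `0`, and `logOneAdd 0 = 0`, so they
  -- contribute to neither side.
  have h2 := lintegral_expNeg_tsum_mul_of_exp hf hf_law hf_indep (fun k =>
    if (k : ℕ∞) < Φ.num ω then ((s * P : ℝ≥0) : ℝ≥0∞) * edist (Φ.pt k ω) b ^ (-α) else 0)
  convert h2 using 1
  · refine lintegral_congr fun ω' => ?_
    rw [interferenceFun, ← ENNReal.tsum_mul_left]
    congr 2 with k
    simp only [PointProcess.toRandomElement]
    by_cases hk : (k : ℕ∞) < Φ.num ω
    · simp only [hk, if_true, ENNReal.coe_mul]; ring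
    · simp [hk]
  · congr 2 with k
    split_ifs <;> simp

/-- The Laplace transform of the interference of a Poisson process with exponential fading. -/
theorem lintegral_expNeg_mul_interference (hΦ : IsHPPP Φ lam μ) (hf : ∀ k, Measurable (f k))
    (hf_law : ∀ k, HasLaw (f k) (expMeasure 1) μ) (hf_indep : iIndepFun f μ)
    (hind : IndepFun Φ.toRandomElement (fun ω k => f k ω) μ) (P s : ℝ≥0) {α : ℝ} (hα : 2 < α)
    (b : Plane) :
    ∫⁻ ω, expNeg (s * interference P α b Φ f ω) ∂μ =
      ENNReal.ofReal (Real.exp (-(lam * ((s * P : ℝ) ^ (2 / α) *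
        (Real.pi * ((2 * Real.pi / α) / Real.sin (2 * Real.pi / α))))))) := by
  rw [lintegral_expNeg_mul_interference_eq hf hf_law hf_indep hind,
    hΦ.lintegral_expNeg_lintegral (by fun_prop)]
  simp_rw [logOneAdd, expNeg_log_one_add]
  have hsin : 0 < Real.sin (2 * Real.pi / α) := by
    refine Real.sin_pos_of_pos_of_lt_pi (by positivity) ?_
    rw [div_lt_iff₀ (by linarith)]
    nlinarith [Real.pi_pos]
  rw [lintegral_plane_one_sub_inv hα, ← ENNReal.ofReal_coe_nnreal,
    ← ENNReal.ofReal_mul (by positivity), expNeg_ofReal (by positivity), NNReal.coe_mul]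

/-- For `s > 0`, `exp (-s I)` vanishes where `I = ∞`, so its expectation is at most the probability
that `I` is finite. By the explicit formula this expectation tends to `1` along `s = 1 / (n + 1)`.
-/
lemma ae_interference_lt_top (hΦ : IsHPPP Φ lam μ) (hf : ∀ k, Measurable (f k))
    (hf_law : ∀ k, HasLaw (f k) (expMeasure 1) μ) (hf_indep : iIndepFun f μ)
    (hind : IndepFun Φ.toRandomElement (fun ω k => f k ω) μ) (P : ℝ≥0) {α : ℝ} (hα : 2 < α)
    (b : Plane) : ∀ᵐ ω ∂μ, interference P α b Φ f ω < ∞ := by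
  have hI := measurable_interference P α b Φ hf
  have hset : MeasurableSet {ω | interference P α b Φ f ω < ∞} := hI measurableSet_Iio
  refine (mem_ae_iff_prob_eq_one hset).2 ?_
  refine le_antisymm prob_le_one ?_
  set C : ℝ := Real.pi * ((2 * Real.pi / α) / Real.sin (2 * Real.pi / α))
  have hle : ∀ n : ℕ, ENNReal.ofReal (Real.exp (-(lam * (((1 / ((n : ℝ≥0) + 1) : ℝ≥0) * P : ℝ) ^
      (2 / α) * C)))) ≤ μ {ω | interference P α b Φ f ω < ∞} := by
    intro n
    rw [← lintegral_expNeg_mul_interference hΦ hf hf_law hf_indep hind P _ hα b,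
      ← lintegral_indicator_one hset]
    refine lintegral_mono fun ω => ?_
    by_cases hω : interference P α b Φ f ω < ∞
    · simpa [hω] using expNeg_le_one _
    · have hs : ((1 / ((n : ℝ≥0) + 1) : ℝ≥0) : ℝ≥0∞) ≠ 0 := by
        rw [Ne, ENNReal.coe_eq_zero]; positivity
      rw [not_lt_top_iff.1 hω, ENNReal.mul_top hs]
      simp
  refine le_of_tendsto' (x := atTop) ?_ hle
  have h0 : Tendsto (fun n : ℕ => ((1 / ((n : ℝ≥0) + 1) : ℝ≥0) * P : ℝ)) atTop (𝓝 0) := by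
    have := (tendsto_one_div_add_atTop_nhds_zero_nat (𝕜 := ℝ)).mul_const (P : ℝ)
    simpa using this
  have h1 := ((h0.rpow_const (p := 2 / α) (Or.inr (by positivity))).mul_const C).const_mul (lam : ℝ)
  rw [Real.zero_rpow (by positivity), zero_mul, mul_zero] at h1
  have h2 := ENNReal.tendsto_ofReal ((Real.continuous_exp.tendsto _).comp h1.neg)
  simpa using h2

end Interference

/-! ### Conditional probability of successful reception -/

/-- The conditional probability, given `X`, of an event about `X` and an independent `Z`. -/
lemma condProb_ae_eq_of_indepFun {Ω β γ : Type*} [MeasurableSpace Ω] [mβ : MeasurableSpace β]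
    [MeasurableSpace γ] [StandardBorelSpace γ] [Nonempty γ] {μ : Measure Ω}
    [IsProbabilityMeasure μ] {X : Ω → β} {Z : Ω → γ} (hX : Measurable X) (hZ : Measurable Z)
    (hind : IndepFun X Z μ) {S : Set (β × γ)} (hS : MeasurableSet S) :
    μ⟦{ω | (X ω, Z ω) ∈ S} | mβ.comap X⟧ =ᵐ[μ] fun ω => μ.real {ω' | (X ω, Z ω') ∈ S} := by
  have hZp : IsProbabilityMeasure (μ.map Z) := Measure.isProbabilityMeasure_map hZ.aemeasurable
  have hXp : IsProbabilityMeasure (μ.map X) := Measure.isProbabilityMeasure_map hX.aemeasurable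
  -- By independence the joint law is a product, so the conditional law of `Z` does not depend on
  -- `X`.
  have hκ : condDistrib Z X μ =ᵐ[μ.map X] Kernel.const β (μ.map Z) := by
    refine condDistrib_ae_eq_of_measure_eq_compProd X hZ.aemeasurable ?_
    rw [Measure.compProd_const]
    exact (indepFun_iff_map_prod_eq_prod_map_map hX.aemeasurable hZ.aemeasurable).1 hind
  have hS' : StronglyMeasurable (S.indicator fun _ => (1 : ℝ)) :=
    stronglyMeasurable_const.indicator hS
  have hSm : MeasurableSet {ω | (X ω, Z ω) ∈ S} := (hX.prodMk hZ) hS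
  have h := condExp_prod_ae_eq_integral_condDistrib (μ := μ) hX hZ.aemeasurable hS'
    ((integrable_const (1 : ℝ)).indicator hSm)
  refine EventuallyEq.trans h ?_
  filter_upwards [ae_of_ae_map hX.aemeasurable hκ] with ω hω
  have hsec : MeasurableSet {z | (X ω, z) ∈ S} := measurable_prodMk_left hS
  rw [hω, Kernel.const_apply]
  have : (fun z => S.indicator (fun _ => (1 : ℝ)) (X ω, z))
      = {z | (X ω, z) ∈ S}.indicator fun _ => 1 := rfl
  rw [this, integral_indicator_const _ hsec, smul_eq_mul, mul_one,
    map_measureReal_apply hZ hsec]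
  rfl

/-- Finiteness of `d` matters only at `ρ = 0`: there the numerator is `∞`, and the ratio would be `∞
/ ∞ = 0` if `d = ∞`. -/
lemma le_mul_rpow_neg_div_iff {τ ρ d a : ℝ≥0∞} {α : ℝ} (hα : 0 < α) (hρ : ρ ≠ ∞) (hd : d ≠ ∞)
    (ha : a ≠ 0) (ha' : a ≠ ∞) : τ ≤ a * ρ ^ (-α) / d ↔ τ * ρ ^ α * d ≤ a := by
  rcases eq_or_ne ρ 0 with rfl | hρ0
  · simp [ENNReal.zero_rpow_of_neg (neg_neg_of_pos hα), ENNReal.zero_rpow_of_pos hα,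
      ENNReal.mul_top ha, ENNReal.top_div_of_ne_top hd]
  have h0 : ρ ^ α ≠ 0 := by simp [ENNReal.rpow_eq_zero_iff, hρ0, hρ]
  have h1 : ρ ^ α ≠ ∞ := ENNReal.rpow_ne_top_of_nonneg hα.le hρ
  have hq0 : a * (ρ ^ α)⁻¹ ≠ 0 := mul_ne_zero ha (ENNReal.inv_ne_zero.2 h1)
  have hq1 : a * (ρ ^ α)⁻¹ ≠ ∞ := ENNReal.mul_ne_top ha' (ENNReal.inv_ne_top.2 h0)
  rw [ENNReal.rpow_neg, ENNReal.le_div_iff_mul_le (Or.inr hq0) (Or.inr hq1), ← div_eq_mul_inv,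
    ENNReal.le_div_iff_mul_le (Or.inl h0) (Or.inl h1), mul_right_comm]

/-- Given `D`, the event is that `h` is at least `τ * ρ ^ α * D`, and the exponential tail at that
level is `expNeg`. -/
lemma measure_le_exp_mul_rpow_neg_div {Ω : Type*} [MeasurableSpace Ω] {μ : Measure Ω}
    [IsProbabilityMeasure μ] {h : Ω → ℝ} (hh : Measurable h) (hh_law : HasLaw h (expMeasure 1) μ)
    {D : Ω → ℝ≥0∞} (hD : Measurable D) (hD_top : ∀ᵐ ω ∂μ, D ω < ∞) (hind : IndepFun D h μ)
    {τ ρ : ℝ≥0∞} {α : ℝ} (hα : 0 < α) (hρ : ρ ≠ ∞) :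
    μ {ω | τ ≤ ENNReal.ofReal (h ω) * ρ ^ (-α) / D ω} = ∫⁻ ω, expNeg (τ * ρ ^ α * D ω) ∂μ := by
  have hP : IsProbabilityMeasure (expMeasure 1) := isProbabilityMeasure_expMeasure one_pos
  have h1 : μ {ω | τ ≤ ENNReal.ofReal (h ω) * ρ ^ (-α) / D ω}
      = μ {ω | (D ω, h ω) ∈ {p : ℝ≥0∞ × ℝ | τ * ρ ^ α * p.1 ≤ ENNReal.ofReal p.2}} := by
    refine measure_congr ?_
    have hpos : ∀ᵐ ω ∂μ, 0 < h ω := by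
      have := ae_pos_expMeasure_one
      rw [← hh_law.map_eq] at this
      exact ae_of_ae_map hh.aemeasurable this
    filter_upwards [hpos, hD_top] with ω hω hDω
    exact propext (le_mul_rpow_neg_div_iff hα hρ hDω.ne (by simpa using hω) (by simp))
  have hS : MeasurableSet {p : ℝ≥0∞ × ℝ | τ * ρ ^ α * p.1 ≤ ENNReal.ofReal p.2} :=
    measurableSet_le (by fun_prop) (by fun_prop)
  have hprod := (indepFun_iff_map_prod_eq_prod_map_map hD.aemeasurable hh.aemeasurable).1 hind
  rw [hh_law.map_eq] at hprod
  refine h1.trans ((Measure.map_apply (hD.prodMk hh) hS).symm.trans ?_)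
  rw [hprod, Measure.prod_apply hS, lintegral_map (measurable_measure_prodMk_left hS) hD]
  exact lintegral_congr fun ω => expMeasure_one_setOf_le_ofReal (τ * ρ ^ α * D ω)

lemma indepFun_of_indep_of_measurable {Ω β γ : Type*} {mΩ : MeasurableSpace Ω}
    [MeasurableSpace β] [MeasurableSpace γ] {μ : Measure Ω} {m₁ m₂ : MeasurableSpace Ω}
    (h : Indep m₁ m₂ μ) {X : Ω → β} {Z : Ω → γ} (hX : Measurable[m₁] X) (hZ : Measurable[m₂] Z) :
    IndepFun X Z μ :=
  indep_of_indep_of_le h hX.comap_le hZ.comap_le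

/-- The conditional probability that the signal to interference and noise ratio exceeds a
threshold, for an arbitrary noise power. -/
theorem condProb_le_sinr {Ω : Type*} [MeasurableSpace Ω] {μ : Measure Ω} [IsProbabilityMeasure μ]
    {lam lamI : ℝ≥0} {α : ℝ} (hα : 2 < α) (b : Plane) {y : Ω → Plane} (hy : Measurable y)
    {h : Ω → ℝ} (hh : Measurable h) (hh_law : HasLaw h (expMeasure 1) μ)
    {Φ : PointProcess Ω Plane} (hΦ : IsHPPP Φ lam μ)
    {f : ℕ → Ω → ℝ} (hf : ∀ k, Measurable (f k)) (hf_law : ∀ k, HasLaw (f k) (expMeasure 1) μ)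
    (hf_indep : iIndepFun f μ)
    {ΦI : PointProcess Ω Plane} (hΦI : IsHPPP ΦI lamI μ)
    {g : ℕ → Ω → ℝ} (hg : ∀ k, Measurable (g k)) (hg_law : ∀ k, HasLaw (g k) (expMeasure 1) μ)
    (hg_indep : iIndepFun g μ)
    (h_indep : iIndep
      ![MeasurableSpace.comap y inferInstance,
        MeasurableSpace.comap h inferInstance,
        MeasurableSpace.comap Φ.toRandomElement inferInstance,
        MeasurableSpace.comap (fun ω k => f k ω) inferInstance,
        MeasurableSpace.comap ΦI.toRandomElement inferInstance,
        MeasurableSpace.comap (fun ω k => g k ω) inferInstance] μ) (PN PI τ : ℝ≥0) :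
    μ⟦{ω | (τ : ℝ≥0∞) ≤ sinr PN PI α b y h Φ f ΦI g ω} |
        MeasurableSpace.comap (fun ω => dist (y ω) b) inferInstance⟧
      =ᵐ[μ] fun ω => Real.exp (-(τ * dist (y ω) b ^ α * PN)) * Real.exp
        (-(interferenceCoeff lam lamI PI α * (τ : ℝ) ^ (2 / α) * dist (y ω) b ^ 2)) := by
  have hα0 : 0 < α := by linarith
  set m : Fin 6 → MeasurableSpace Ω :=
    ![MeasurableSpace.comap y inferInstance,
      MeasurableSpace.comap h inferInstance,
      MeasurableSpace.comap Φ.toRandomElement inferInstance,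
      MeasurableSpace.comap (fun ω k => f k ω) inferInstance,
      MeasurableSpace.comap ΦI.toRandomElement inferInstance,
      MeasurableSpace.comap (fun ω k => g k ω) inferInstance]
  have hfm : Measurable fun ω k => f k ω := measurable_pi_lambda _ hf
  have hgm : Measurable fun ω k => g k ω := measurable_pi_lambda _ hg
  have hle : ∀ i, m i ≤ ‹MeasurableSpace Ω› := by
    intro i
    fin_cases i
    exacts [hy.comap_le, hh.comap_le, Φ.measurable_toRandomElement.comap_le, hfm.comap_le,
      ΦI.measurable_toRandomElement.comap_le, hgm.comap_le]
  have hmy : Measurable[m 0] y := comap_measurable y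
  have hmh : Measurable[m 1] h := comap_measurable h
  have hmΦ : Measurable[m 2] Φ.toRandomElement := comap_measurable _
  have hmf : Measurable[m 3] fun ω k => f k ω := comap_measurable _
  have hmΦI : Measurable[m 4] ΦI.toRandomElement := comap_measurable _
  have hmg : Measurable[m 5] fun ω k => g k ω := comap_measurable _
  -- Each derived quantity is measurable with respect to a block of the six independent sources;
  -- disjoint blocks then give every independence needed below.
  have hI : ∀ T : Set (Fin 6), 2 ∈ T → 3 ∈ T →
      Measurable[⨆ i ∈ T, m i] (interference 1 α b Φ f) := fun T h2 h3 =>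
    (measurable_interferenceFun 1 α b).comp
      (Measurable.prodMk (hmΦ.mono (le_biSup m h2) le_rfl) (hmf.mono (le_biSup m h3) le_rfl))
  have hJ : ∀ T : Set (Fin 6), 4 ∈ T → 5 ∈ T →
      Measurable[⨆ i ∈ T, m i] (interference PI α b ΦI g) := fun T h4 h5 =>
    (measurable_interferenceFun PI α b).comp
      (Measurable.prodMk (hmΦI.mono (le_biSup m h4) le_rfl) (hmg.mono (le_biSup m h5) le_rfl))
  let D : Ω → ℝ≥0∞ := fun ω => (PN : ℝ≥0∞) + interference 1 α b Φ f ω + interference PI α b ΦI g ω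
  have hDT : ∀ T : Set (Fin 6), 2 ∈ T → 3 ∈ T → 4 ∈ T → 5 ∈ T → Measurable[⨆ i ∈ T, m i] D :=
    fun T h2 h3 h4 h5 => ((hI T h2 h3).const_add _).add (hJ T h4 h5)
  have hIm := measurable_interference 1 α b Φ hf
  have hJm := measurable_interference PI α b ΦI hg
  have hDm : Measurable D := (hIm.const_add _).add hJm
  have hΦf : IndepFun Φ.toRandomElement (fun ω k => f k ω) μ :=
    h_indep.indep (show (2 : Fin 6) ≠ 3 by decide)
  have hΦIg : IndepFun ΦI.toRandomElement (fun ω k => g k ω) μ :=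
    h_indep.indep (show (4 : Fin 6) ≠ 5 by decide)
  have hIJ : IndepFun (interference 1 α b Φ f) (interference PI α b ΦI g) μ :=
    indepFun_of_indep_of_measurable
      (indep_iSup_of_disjoint hle h_indep (S := {2, 3}) (T := {4, 5}) (by simp))
      (hI _ (by simp) (by simp)) (hJ _ (by simp) (by simp))
  have hDh : IndepFun D h μ :=
    indepFun_of_indep_of_measurable
      (indep_iSup_of_disjoint hle h_indep (S := {2, 3, 4, 5}) (T := {1}) (by simp))
      (hDT _ (by simp) (by simp) (by simp) (by simp))
      (hmh.mono (le_biSup m (Set.mem_singleton _)) le_rfl)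
  have hyZ : IndepFun (fun ω => dist (y ω) b) (fun ω => (h ω, D ω)) μ := by
    refine indepFun_of_indep_of_measurable
      (indep_iSup_of_disjoint hle h_indep (S := {0}) (T := {1, 2, 3, 4, 5}) (by simp))
      ((measurable_id.dist measurable_const).comp
        (hmy.mono (le_biSup m (Set.mem_singleton _)) le_rfl))
      (Measurable.prodMk (hmh.mono (le_biSup m (by simp)) le_rfl)
        (hDT _ (by simp) (by simp) (by simp) (by simp)))
  have hD_top : ∀ᵐ ω ∂μ, D ω < ∞ := by
    filter_upwards [ae_interference_lt_top hΦ hf hf_law hf_indep hΦf 1 hα b,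
      ae_interference_lt_top hΦI hg hg_law hg_indep hΦIg PI hα b] with ω h1 h2
    exact ENNReal.add_lt_top.2 ⟨ENNReal.add_lt_top.2 ⟨by simp, h1⟩, h2⟩
  -- The location enters the event only through its distance to `b`, so conditioning on that
  -- distance suffices.
  let S : Set (ℝ × (ℝ × ℝ≥0∞)) :=
    {p | (τ : ℝ≥0∞) ≤ ENNReal.ofReal p.2.1 * ENNReal.ofReal p.1 ^ (-α) / p.2.2}
  have hS : MeasurableSet S := measurableSet_le (by fun_prop) (by fun_prop)
  have hset : {ω | (τ : ℝ≥0∞) ≤ sinr PN PI α b y h Φ f ΦI g ω}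
      = {ω | (dist (y ω) b, (h ω, D ω)) ∈ S} := by
    ext ω
    simp only [S, sinr, edist_dist, D, Set.mem_ofPred_eq]
  rw [hset]
  refine (condProb_ae_eq_of_indepFun (hy.dist measurable_const) (hh.prodMk hDm) hyZ hS).trans
    (ae_of_all _ fun ω => ?_)
  beta_reduce
  set r : ℝ := dist (y ω) b
  have hr : 0 ≤ r := dist_nonneg
  have hprob := measure_le_exp_mul_rpow_neg_div hh hh_law hDm hD_top hDh (τ := τ)
    (ρ := ENNReal.ofReal r) hα0 (by simp)
  -- The parameter at which the Laplace transforms are evaluated.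
  obtain ⟨s, hs⟩ : ∃ s : ℝ≥0, (s : ℝ) = τ * r ^ α := ⟨⟨τ * r ^ α, by positivity⟩, rfl⟩
  have hs' : (τ : ℝ≥0∞) * ENNReal.ofReal r ^ α = s := by
    rw [← ENNReal.ofReal_coe_nnreal, ENNReal.ofReal_rpow_of_nonneg hr hα0.le,
      ← ENNReal.ofReal_mul (by positivity), ← hs, ENNReal.ofReal_coe_nnreal]
  have hsplit : ∀ ω, expNeg (s * D ω) = expNeg (s * PN) *
      (expNeg (s * interference 1 α b Φ f ω) * expNeg (s * interference PI α b ΦI g ω)) := by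
    intro ω
    simp only [D, mul_add, expNeg_add, mul_assoc]
  have hF : Measurable fun t : ℝ≥0∞ => expNeg (s * t) := by fun_prop
  have hfac := lintegral_mul_eq_lintegral_mul_lintegral_of_indepFun (hF.comp hIm) (hF.comp hJm)
    (hIJ.comp hF hF)
  simp only [Pi.mul_apply, Function.comp_apply] at hfac
  have hpow : ((s : ℝ)) ^ (2 / α) = (τ : ℝ) ^ (2 / α) * r ^ 2 := by
    rw [hs, Real.mul_rpow (by positivity) (by positivity), ← Real.rpow_mul hr,
      mul_div_cancel₀ _ hα0.ne']
    norm_num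
  rw [measureReal_def]
  refine (congrArg ENNReal.toReal hprob).trans ?_
  simp_rw [hs', hsplit]
  rw [lintegral_const_mul' _ _ (expNeg_ne_top _), hfac,
    lintegral_expNeg_mul_interference hΦ hf hf_law hf_indep hΦf 1 s hα b,
    lintegral_expNeg_mul_interference hΦI hg hg_law hg_indep hΦIg PI s hα b, ← ENNReal.coe_mul,
    ← ENNReal.ofReal_coe_nnreal, expNeg_ofReal (by positivity),
    ← ENNReal.ofReal_mul (by positivity), ← ENNReal.ofReal_mul (by positivity),
    ENNReal.toReal_ofReal (by positivity), ← hs, ← Real.exp_add, ← Real.exp_add, ← Real.exp_add,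
    NNReal.coe_mul, NNReal.coe_one, mul_one, Real.mul_rpow (by positivity) (by positivity), hpow,
    interferenceCoeff]
  congr 1
  ring

/-! ### The theorem -/

theorem theorem1 {Ω : Type*} [MeasurableSpace Ω] (μ : Measure Ω) [IsProbabilityMeasure μ]
    (lam lamI PI τ : ℝ≥0) (α : ℝ) (hα : 2 < α)
    -- receiver, random location of the device, and its fading gain
    (b : Plane) (y : Ω → Plane) (hy : Measurable y)
    (h : Ω → ℝ) (hh : Measurable h) (hh_law : HasLaw h (expMeasure 1) μ)
    -- interfering IoT devices and their fading gains
    (Φ : PointProcess Ω Plane) (hΦ : IsHPPP Φ lam μ)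
    (f : ℕ → Ω → ℝ) (hf : ∀ k, Measurable (f k)) (hf_law : ∀ k, HasLaw (f k) (expMeasure 1) μ)
    (hf_indep : iIndepFun f μ)
    -- incumbents on the band and their fading gains
    (ΦI : PointProcess Ω Plane) (hΦI : IsHPPP ΦI lamI μ)
    (g : ℕ → Ω → ℝ) (hg : ∀ k, Measurable (g k)) (hg_law : ∀ k, HasLaw (g k) (expMeasure 1) μ)
    (hg_indep : iIndepFun g μ)
    -- the location, the gain, the two point processes and the two gain sequences are independent
    (h_indep : iIndep
      ![MeasurableSpace.comap y inferInstance,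
        MeasurableSpace.comap h inferInstance,
        MeasurableSpace.comap Φ.toRandomElement inferInstance,
        MeasurableSpace.comap (fun ω k => f k ω) inferInstance,
        MeasurableSpace.comap ΦI.toRandomElement inferInstance,
        MeasurableSpace.comap (fun ω k => g k ω) inferInstance] μ) :
    -- without noise
    (μ⟦{ω | (τ : ℝ≥0∞) ≤ sinr 0 PI α b y h Φ f ΦI g ω} |
        MeasurableSpace.comap (fun ω => dist (y ω) b) inferInstance⟧
      =ᵐ[μ] fun ω => Real.exp
        (-(interferenceCoeff lam lamI PI α * (τ : ℝ) ^ (2 / α) * dist (y ω) b ^ 2))) ∧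
    -- in the limit of vanishing noise
    (∀ PN : ℕ → ℝ≥0, Tendsto PN atTop (𝓝 0) → ∀ᵐ ω ∂μ,
      Tendsto (fun n => (μ⟦{ω | (τ : ℝ≥0∞) ≤ sinr (PN n) PI α b y h Φ f ΦI g ω} |
          MeasurableSpace.comap (fun ω => dist (y ω) b) inferInstance⟧) ω) atTop
        (𝓝 (Real.exp
          (-(interferenceCoeff lam lamI PI α * (τ : ℝ) ^ (2 / α) * dist (y ω) b ^ 2))))) ∧
    -- for a large path-loss exponent the power of the incumbents becomes irrelevant
    (0 < PI → Tendsto (fun a : ℝ => (PI : ℝ) ^ (2 / a) * (lamI : ℝ)) atTop (𝓝 (lamI : ℝ))) := by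
  have key := fun PN => condProb_le_sinr hα b hy hh hh_law hΦ hf hf_law hf_indep hΦI hg hg_law
    hg_indep h_indep PN PI τ
  refine ⟨?_, fun PN hPN => ?_, fun hPI => ?_⟩
  · simpa using key 0
  -- Each conditional probability is fixed only up to a null set; a sequence of noise powers
  -- involves countably many of them. Outside their union only the factor `exp (-τ r ^ α PN)`
  -- varies, and it tends to `1`.
  · filter_upwards [ae_all_iff.2 fun n => key (PN n)] with ω hω
    simp_rw [hω]
    have h1 : Tendsto (fun n => -((τ : ℝ) * dist (y ω) b ^ α * PN n)) atTop (𝓝 0) := by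
      simpa using ((NNReal.tendsto_coe.2 hPN).const_mul ((τ : ℝ) * dist (y ω) b ^ α)).neg
    simpa using ((Real.continuous_exp.tendsto _).comp h1).mul_const _
  · have h1 : Tendsto (fun a : ℝ => 2 / a) atTop (𝓝 0) := tendsto_const_nhds.div_atTop tendsto_id
    have h2 : (PI : ℝ) ≠ 0 := by positivity
    simpa using ((Real.continuousAt_const_rpow h2).tendsto.comp h1).mul_const (lamI : ℝ)
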